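/- Let $\mathbb F_q$ be a finite field with $q$ elements and let $n\ge 0$. Let $B_q(n)$ be the set of all subspaces of $\mathbb F_q^n$, and let $\mathbb C[B_q(n)]$ be the complex vector space with basis $B_q(n)$; for $v\in\mathbb C[B_q(n)]$ write $v=\sum_X v(X)\,X$. Identify $\mathbb F_q^n$ with the subspace of $\mathbb F_q^{n+1}$ of vectors whose last component is $0$, so that $\mathbb C[B_q(n)]\subseteq \mathbb C[B_q(n+1)]$, and let $\theta_n:\mathbb C[B_q(n)]\to\mathbb C[B_q(n+1)]$ be the linear map sending $X\in B_q(n)$ to the sum of all subspaces $Y\subseteq\mathbb F_q^{n+1}$ that cover $X$ and satisfy $Y\not\subseteq\mathbb F_q^n$. For a sequence $\alpha=(\alpha_1,\dots,\alpha_n)\in\{0,1\}^n$ put $S(\alpha)=\{i:\alpha_i=1\}$ and $N(\alpha)=|S(\alpha)|$, and define $v_\alpha\in\mathbb C[B_q(n)]$ recursively by $v_{()}=\{0\}$ and, for $\beta\in\{0,1\}^n$ with $k=N(\beta)$, $$v_{(\beta,0)}=q^{k}v_\beta+\theta_n(v_\beta),\qquad v_{(\beta,1)}=q^{n-k}v_\beta-\theta_n(v_\beta).$$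 For $1\le i\le n$ put $d(\alpha,i)=|\{j<i:\alpha_j\ne\alpha_i\}|$. Each $X\in B_q(n)$ of dimension $m$ is the column space of a unique $n\times m$ matrix in Schubert normal form, that is, a matrix such that the last nonzero entry of each column $j$ is a $1$, in row $r_j$ say, with $r_1<\dots<r_m$, and such that rows $r_1,\dots,r_m$ form the identity matrix. Let $P(X)=\{r_1,\dots,r_m\}$ and $d(\alpha,X)=\sum_{i\in\{1,\dots,n\}\setminus P(X)}d(\alpha,i)$. Let $M_q(n)$ be the $B_q(n)\times B_q(n)$ matrix with entry $(X,Y)$ equal to $1$ if $Y\subseteq X$ and $\dim Y=\dim X-1$, to $q^{\dim X}$ if $X\subseteq Y$ and $\dim Y=\dim X+1$, and to $0$ otherwise, and let $(m)_q=1+q+\dots+q^{m-1}$. Let $M(n)$ be the adjacency matrix of the $n$-cube, indexed by the subsets of $\{1,\dots,n\}$, with $S,T$ adjacent if and only if $|(S\setminus T)\cup(T\setminus S)|=1$. **Theorem.** Let $\alpha\in\{0,1\}^n$ and $k=N(\alpha)$. 1. The vector $v_\alpha$ is nonzero and, regarded as a column vector indexed by $B_q(n)$, satisfies $M_q(n)\,v_\alpha=((n-k)_q-(k)_q)\,v_\alpha$.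 2. $$v_\alpha=\sum_{X\in B_q(n)}(-1)^{|S(\alpha)\cap P(X)|}\,q^{d(\alpha,X)}\,X .$$ 3. In particular, $v_\alpha(\{0\})=q^{k(n-k)}$ and $v_\alpha(\mathbb F_q^n)=(-1)^k$. 4. At $q=1$ the formula gives the classical eigenvectors of the $n$-cube: for $T\subseteq\{1,\dots,n\}$, putting $q=1$ in $(-1)^{|S(\alpha)\cap T|}q^{\sum_{i\notin T}d(\alpha,i)}$ gives $(-1)^{|S(\alpha)\cap T|}$, and the vector $w_\alpha$ with components $w_\alpha(T)=(-1)^{|S(\alpha)\cap T|}$ satisfies $M(n)\,w_\alpha=(n-2k)\,w_\alpha$. -/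

import Mathlib

namespace QCube

/-- The number of subspaces of `F ^ n` is finite when `F` is finite. -/
noncomputable instance subspaceFintype (F : Type*) [Field F] [Fintype F] (n : ℕ) :
    Fintype (Submodule F (Fin n → F)) :=
  Fintype.ofFinite _

/-- `ℂ[B_q(n)]`: the complex vector space whose basis is the set of subspaces of `F ^ n`;
the basis element `X` is `Finsupp.single X 1`, and `v X` is the coefficient of `X` in `v`. -/
abbrev SubspaceAlgebra (F : Type*) [Field F] (n : ℕ) : Type _ :=
  Submodule F (Fin n → F) →₀ ℂ

/-- The identification of `F ^ n` with the vectors of `F ^ (n + 1)` whose last component is `0`. -/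
def incl (F : Type*) [Field F] (n : ℕ) : (Fin n → F) →ₗ[F] (Fin (n + 1) → F) where
  toFun x := Fin.snoc (α := fun _ => F) x 0
  map_add' x y := by
    funext i
    refine Fin.lastCases ?_ (fun j => ?_) i <;> simp
  map_smul' c x := by
    funext i
    refine Fin.lastCases ?_ (fun j => ?_) i <;> simp

/-- The inclusion `ℂ[B_q(n)] ⊆ ℂ[B_q(n+1)]`. -/
noncomputable def extend (F : Type*) [Field F] (n : ℕ) :
    SubspaceAlgebra F n →ₗ[ℂ] SubspaceAlgebra F (n + 1) :=
  Finsupp.lmapDomain ℂ ℂ (fun X => X.map (incl F n))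

open Classical in
/-- The linear map `θ_n : ℂ[B_q(n)] → ℂ[B_q(n+1)]` which sends a subspace `X` of `F ^ n` to the sum
of all subspaces `Y` of `F ^ (n + 1)` that cover `X` and are not contained in `F ^ n`. -/
noncomputable def theta (F : Type*) [Field F] [Fintype F] (n : ℕ) :
    SubspaceAlgebra F n →ₗ[ℂ] SubspaceAlgebra F (n + 1) :=
  Finsupp.linearCombination ℂ (fun X : Submodule F (Fin n → F) =>
    ∑ Y : Submodule F (Fin (n + 1) → F) with
      (¬ Y ≤ LinearMap.range (incl F n)) ∧ X.map (incl F n) ⋖ Y,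
      Finsupp.single Y (1 : ℂ))

/-- `S(α)`, the set of positions of the entry `1` (here `true`) in a 0/1 sequence. -/
def ones {n : ℕ} (α : Fin n → Bool) : Finset (Fin n) :=
  {i | α i = true}

/-- `N(α)`, the number of nonzero entries. -/
def weight {n : ℕ} (α : Fin n → Bool) : ℕ := (ones α).card

/-- The vectors `v_α`, for `α` a 0/1 sequence of length `n`: `v_() = {0}`, and if
`β = (α_1, …, α_n)`, `k = N(β)`, then `v_(β,0) = q^k v_β + θ_n(v_β)` and
`v_(β,1) = q^(n-k) v_β - θ_n(v_β)`. -/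
noncomputable def vec (F : Type*) [Field F] [Fintype F] :
    (n : ℕ) → (Fin n → Bool) → SubspaceAlgebra F n
  | 0, _ => Finsupp.single ⊥ 1
  | n + 1, α =>
    let β : Fin n → Bool := fun i => α i.castSucc
    if α (Fin.last n) = true then
      ((Fintype.card F : ℂ) ^ (n - weight β)) • extend F n (vec F n β) - theta F n (vec F n β)
    else
      ((Fintype.card F : ℂ) ^ weight β) • extend F n (vec F n β) + theta F n (vec F n β)

/-- `M` is in Schubert normal form (column reduced echelon form) and the last nonzero entry of
column `j` is in row `r j`. -/
structure IsSchubertNormalForm {F : Type*} [Field F] {n k : ℕ}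
    (M : Matrix (Fin n) (Fin k) F) (r : Fin k → Fin n) : Prop where
  pivot_eq_one : ∀ j, M (r j) j = 1
  zero_below : ∀ j i, r j < i → M i j = 0
  strictMono : StrictMono r
  submatrix_eq_one : M.submatrix r id = 1

open Classical in
/-- `P(X)`, the set of pivotal indices of the matrix in Schubert normal form with column
space `X`. -/
noncomputable def pivots {F : Type*} [Field F] {n : ℕ} (X : Submodule F (Fin n → F)) :
    Finset (Fin n) :=
  {i | ∃ (k : ℕ) (M : Matrix (Fin n) (Fin k) F) (r : Fin k → Fin n),
    IsSchubertNormalForm M r ∧ Submodule.span F (Set.range M.col) = X ∧ i ∈ Set.range r}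

/-- `d(α, i)`, the number of `j < i` with `α_j ≠ α_i`. -/
def dist {n : ℕ} (α : Fin n → Bool) (i : Fin n) : ℕ :=
  Finset.card {j : Fin n | j < i ∧ α j ≠ α i}

/-- The coefficient `(-1)^|S(α) ∩ T| q^d`, where `d` is the sum of `d(α, i)` over `i ∉ T`. -/
noncomputable def coeff (q : ℂ) {n : ℕ} (α : Fin n → Bool) (T : Finset (Fin n)) : ℂ :=
  (-1) ^ (ones α ∩ T).card * q ^ (∑ i ∈ Tᶜ, dist α i)

/-- `(m)_q = 1 + q + ⋯ + q^(m-1)`. -/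
noncomputable def qNum (q : ℂ) (m : ℕ) : ℂ := ∑ i ∈ Finset.range m, q ^ i

open Classical in
/-- The matrix `M_q(n)`, the `q`-analog of the adjacency matrix of the `n`-cube. -/
noncomputable def qCubeMatrix (F : Type*) [Field F] [Fintype F] (n : ℕ) :
    Matrix (Submodule F (Fin n → F)) (Submodule F (Fin n → F)) ℂ :=
  Matrix.of fun X Y =>
    if Y ≤ X ∧ Module.finrank F X = Module.finrank F Y + 1 then 1
    else if X ≤ Y ∧ Module.finrank F Y = Module.finrank F X + 1 then
      (Fintype.card F : ℂ) ^ Module.finrank F X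
    else 0

/-- The adjacency matrix `M(n)` of the `n`-cube, with rows and columns indexed by the subsets of
an `n`-element set. -/
def cubeMatrix (n : ℕ) : Matrix (Finset (Fin n)) (Finset (Fin n)) ℂ :=
  Matrix.of fun S T => if ((S \ T) ∪ (T \ S)).card = 1 then 1 else 0

end QCube

/-! Everything is organised by the trace `Z.comap (incl F n)` of a subspace `Z` of `F ^ (n + 1)` on
the hyperplane `F ^ n`. By `vec_succ_apply`, passing from length `n` to `n + 1` multiplies the
coefficient at the trace by `q ^ d(α, n + 1)` if `Z` lies in the hyperplane, and by a sign
otherwise. The pivots of `Z` are those of its trace, plus the last index exactly in the second case,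
so the explicit formula follows by induction. For the eigenvalue, let `u` be `a * v` of the trace on
the hyperplane and `s * v` of the trace off it. If `M_q(n) v = λ v`, then `qCubeMatrix_mulVec_succ`
gives the multiples `a λ + s q^n` and `a + s q λ` of `v` at the trace. For `a = q^k, s = 1` and for
`a = q^(n-k), s = -1`, these equal `a λ'` and `s λ'` with the same new eigenvalue `λ'`. -/

namespace QCube

/-! ### Subspaces of `F ^ (n + 1)` and their traces on `F ^ n`. -/

section Hyperplane

variable {F : Type*} [Field F] {n : ℕ}

@[simp] lemma incl_castSucc (x : Fin n → F) (i : Fin n) : incl F n x i.castSucc = x i := by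
  simp [incl]

@[simp] lemma incl_last (x : Fin n → F) : incl F n x (Fin.last n) = 0 := by
  simp [incl]

lemma incl_injective : Function.Injective (incl F n) := fun x y h => by
  funext i
  simpa using congrFun h i.castSucc

lemma mem_range_incl {x : Fin (n + 1) → F} :
    x ∈ LinearMap.range (incl F n) ↔ x (Fin.last n) = 0 := by
  refine ⟨?_, fun h => ⟨fun i => x i.castSucc, ?_⟩⟩
  · rintro ⟨y, rfl⟩
    simp
  · funext i
    refine Fin.lastCases ?_ (fun j => ?_) i <;> simp [h]

lemma comap_map_incl (X : Submodule F (Fin n → F)) :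
    (X.map (incl F n)).comap (incl F n) = X :=
  Submodule.comap_map_eq_of_injective incl_injective X

lemma map_incl_le_range (X : Submodule F (Fin n → F)) :
    X.map (incl F n) ≤ LinearMap.range (incl F n) :=
  LinearMap.map_le_range

lemma map_comap_incl {Z : Submodule F (Fin (n + 1) → F)} (hZ : Z ≤ LinearMap.range (incl F n)) :
    (Z.comap (incl F n)).map (incl F n) = Z :=
  Submodule.map_comap_eq_of_le hZ

lemma finrank_map_incl (X : Submodule F (Fin n → F)) :
    Module.finrank F (X.map (incl F n)) = Module.finrank F X :=
  (Submodule.equivMapOfInjective _ incl_injective X).finrank_eq.symm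

lemma map_incl_le_iff {X : Submodule F (Fin n → F)} {Z : Submodule F (Fin (n + 1) → F)} :
    X.map (incl F n) ≤ Z ↔ X ≤ Z.comap (incl F n) :=
  Submodule.map_le_iff_le_comap

lemma exists_mem_last_eq_one {Z : Submodule F (Fin (n + 1) → F)}
    (hZ : ¬ Z ≤ LinearMap.range (incl F n)) : ∃ z ∈ Z, z (Fin.last n) = 1 := by
  obtain ⟨z, hz, h⟩ := SetLike.not_le_iff_exists.1 hZ
  rw [mem_range_incl] at h
  exact ⟨(z (Fin.last n))⁻¹ • z, Z.smul_mem _ hz, by simp [h]⟩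

lemma not_le_range_of_mem {Z : Submodule F (Fin (n + 1) → F)} {z : Fin (n + 1) → F} (hz : z ∈ Z)
    (h : z (Fin.last n) = 1) : ¬ Z ≤ LinearMap.range (incl F n) := fun hZ =>
  one_ne_zero (h.symm.trans (mem_range_incl.1 (hZ hz)))

/-- A subspace not contained in `F ^ n` is spanned by its part in `F ^ n` and any of its vectors
with last component `1`. -/
lemma eq_map_comap_sup_span {Z : Submodule F (Fin (n + 1) → F)} {z : Fin (n + 1) → F} (hz : z ∈ Z)
    (h : z (Fin.last n) = 1) :
    Z = (Z.comap (incl F n)).map (incl F n) ⊔ Submodule.span F {z} := by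
  refine le_antisymm (fun y hy => ?_) (sup_le (Submodule.map_comap_le _ _) (by simpa))
  obtain ⟨x, hx⟩ : y - y (Fin.last n) • z ∈ LinearMap.range (incl F n) :=
    mem_range_incl.2 (by simp [h])
  refine Submodule.mem_sup.2 ⟨_, ⟨x, ?_, rfl⟩, y (Fin.last n) • z,
    Submodule.smul_mem _ _ (Submodule.mem_span_singleton_self z), by simp [hx]⟩
  rw [SetLike.mem_coe, Submodule.mem_comap, hx]
  exact Z.sub_mem hy (Z.smul_mem _ hz)

lemma comap_map_sup_span (X : Submodule F (Fin n → F)) {z : Fin (n + 1) → F}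
    (h : z (Fin.last n) = 1) :
    (X.map (incl F n) ⊔ Submodule.span F {z}).comap (incl F n) = X := by
  refine le_antisymm (fun x hx => ?_) ?_
  · obtain ⟨_, ⟨y, hy, rfl⟩, w, hw, hs⟩ := Submodule.mem_sup.1 (Submodule.mem_comap.1 hx)
    obtain ⟨c, rfl⟩ := Submodule.mem_span_singleton.1 hw
    have hc : c = 0 := by simpa [h] using congrFun hs (Fin.last n)
    rw [hc, zero_smul, add_zero] at hs
    exact incl_injective hs ▸ hy
  · exact Submodule.map_le_iff_le_comap.1 le_sup_left

lemma finrank_of_not_le {Z : Submodule F (Fin (n + 1) → F)}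
    (hZ : ¬ Z ≤ LinearMap.range (incl F n)) :
    Module.finrank F Z = Module.finrank F (Z.comap (incl F n)) + 1 := by
  obtain ⟨z, hz, h⟩ := exists_mem_last_eq_one hZ
  have hd := Submodule.finrank_sup_add_finrank_inf_eq ((Z.comap (incl F n)).map (incl F n))
    (Submodule.span F {z})
  have h0 : (Z.comap (incl F n)).map (incl F n) ⊓ Submodule.span F {z} = ⊥ := by
    rw [eq_bot_iff]
    rintro y ⟨hy, hy'⟩
    obtain ⟨c, rfl⟩ := Submodule.mem_span_singleton.1 hy'
    have := mem_range_incl.1 (map_incl_le_range _ hy)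
    simp only [Pi.smul_apply, h, smul_eq_mul, mul_one] at this
    simp [this]
  rw [← eq_map_comap_sup_span hz h, h0, finrank_bot, finrank_map_incl,
    finrank_span_singleton (by rintro rfl; simp at h)] at hd
  exact hd

/-- The trace of `Y` has codimension one in `Y`, and any subspace of `F ^ n` inside `Y` lies in it.
This trades the covering condition in `theta` for one on the trace. -/
lemma map_incl_covBy_iff {X : Submodule F (Fin n → F)} {Y : Submodule F (Fin (n + 1) → F)}
    (hY : ¬ Y ≤ LinearMap.range (incl F n)) :
    X.map (incl F n) ⋖ Y ↔ Y.comap (incl F n) = X := by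
  constructor
  · intro h
    have h1 : X.map (incl F n) ≤ (Y.comap (incl F n)).map (incl F n) :=
      Submodule.map_mono (Submodule.map_le_iff_le_comap.1 h.le)
    rcases h.eq_or_eq h1 (Submodule.map_comap_le _ _) with h2 | h2
    · exact Submodule.map_injective_of_injective incl_injective h2
    · exact absurd (h2 ▸ map_incl_le_range _) hY
  · rintro rfl
    refine ⟨lt_of_le_of_ne (Submodule.map_comap_le _ _) fun h => hY (h ▸ map_incl_le_range _), ?_⟩
    intro W h1 h2
    have h3 := Submodule.finrank_lt_finrank_of_lt h1
    have h4 := Submodule.finrank_lt_finrank_of_lt h2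
    rw [finrank_map_incl] at h3
    rw [finrank_of_not_le hY] at h4
    omega

lemma extend_apply_of_le (v : SubspaceAlgebra F n) {Z : Submodule F (Fin (n + 1) → F)}
    (hZ : Z ≤ LinearMap.range (incl F n)) : extend F n v Z = v (Z.comap (incl F n)) := by
  conv_lhs => rw [← map_comap_incl hZ]
  exact Finsupp.mapDomain_apply (Submodule.map_injective_of_injective incl_injective) v _

lemma extend_apply_of_not_le (v : SubspaceAlgebra F n) {Z : Submodule F (Fin (n + 1) → F)}
    (hZ : ¬ Z ≤ LinearMap.range (incl F n)) : extend F n v Z = 0 := by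
  refine Finsupp.mapDomain_of_notMem_range v _ ?_
  rintro ⟨X, rfl⟩
  exact hZ (map_incl_le_range _)

variable [Fintype F]

-- Off the hyperplane `Z` occurs in the image of exactly one basis element, its trace.
open Classical in
lemma theta_apply (v : SubspaceAlgebra F n) (Z : Submodule F (Fin (n + 1) → F)) :
    theta F n v Z = if Z ≤ LinearMap.range (incl F n) then 0 else v (Z.comap (incl F n)) := by
  rw [theta, Finsupp.linearCombination_apply, Finsupp.sum_fintype _ _ (by simp)]
  simp only [Finsupp.coe_finsetSum, Finset.sum_apply, Finsupp.smul_apply, smul_eq_mul,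
    Finset.sum_filter]
  split_ifs with hZ
  · refine Finset.sum_eq_zero fun X _ => ?_
    rw [Finset.sum_eq_zero, mul_zero]
    intro Y _
    split_ifs with h
    · exact Finsupp.single_eq_of_ne (by rintro rfl; exact h.1 hZ)
    · rfl
  · rw [Finset.sum_eq_single (Z.comap (incl F n))]
    · rw [Finset.sum_eq_single Z]
      · simp [hZ, map_incl_covBy_iff hZ]
      · intro Y _ hY
        split_ifs
        · exact Finsupp.single_eq_of_ne hY.symm
        · rfl
      · simp
    · intro X _ hX
      rw [Finset.sum_eq_zero, mul_zero]
      intro Y _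
      split_ifs with h
      · refine Finsupp.single_eq_of_ne ?_
        rintro rfl
        exact hX ((map_incl_covBy_iff hZ).1 h.2).symm
      · rfl
    · simp

/-- The number of vectors with last component `1` in a subspace not contained in `F ^ n`. -/
lemma card_last_eq_one {Z : Submodule F (Fin (n + 1) → F)}
    (hZ : ¬ Z ≤ LinearMap.range (incl F n)) :
    Nat.card {z : Fin (n + 1) → F // z ∈ Z ∧ z (Fin.last n) = 1} =
      Fintype.card F ^ Module.finrank F (Z.comap (incl F n)) := by
  obtain ⟨z, hz, h⟩ := exists_mem_last_eq_one hZ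
  rw [← Nat.card_eq_fintype_card, ← Module.natCard_eq_pow_finrank]
  -- Translation by `z` carries the trace onto the affine slice.
  refine (Nat.card_congr (Equiv.ofBijective
    (fun x : Z.comap (incl F n) => ⟨incl F n x + z, Z.add_mem x.2 hz, by simp [h]⟩) ⟨?_, ?_⟩)).symm
  · intro x y hxy
    exact Subtype.ext (incl_injective (add_right_cancel (congrArg Subtype.val hxy)))
  · rintro ⟨y, hy, hy1⟩
    obtain ⟨x, hx⟩ : y - z ∈ LinearMap.range (incl F n) :=
      mem_range_incl.2 (by simp [h, hy1])
    exact ⟨⟨x, by rw [Submodule.mem_comap, hx]; exact Z.sub_mem hy hz⟩,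
      Subtype.ext (by simp [hx])⟩

open Classical in
/-- The number of subspaces of `Z`, not contained in `F ^ n`, with a given part in `F ^ n`. -/
lemma card_le_comap_eq {Z : Submodule F (Fin (n + 1) → F)}
    (hZ : ¬ Z ≤ LinearMap.range (incl F n)) {X : Submodule F (Fin n → F)}
    (hX : X ≤ Z.comap (incl F n)) :
    Finset.card {Y : Submodule F (Fin (n + 1) → F) |
      (¬ Y ≤ LinearMap.range (incl F n) ∧ Y.comap (incl F n) = X) ∧ Y ≤ Z} =
      Fintype.card F ^ (Module.finrank F (Z.comap (incl F n)) - Module.finrank F X) := by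
  -- Count the slice of `Z` along `z ↦ X + ⟨z⟩`: the fibre over `Y` is the slice of `Y`, of size `q
  -- ^ dim X`.
  have key := Finset.card_eq_sum_card_fiberwise
    (s := ({z | z ∈ Z ∧ z (Fin.last n) = 1} : Finset (Fin (n + 1) → F)))
    (f := fun z => X.map (incl F n) ⊔ Submodule.span F {z})
    (t := {Y : Submodule F (Fin (n + 1) → F) |
      (¬ Y ≤ LinearMap.range (incl F n) ∧ Y.comap (incl F n) = X) ∧ Y ≤ Z}) (by
    intro z hz
    simp only [Finset.coe_filter, Finset.mem_univ, true_and, Set.mem_ofPred_eq] at hz ⊢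
    refine ⟨⟨not_le_range_of_mem (Submodule.mem_sup_right
      (Submodule.mem_span_singleton_self z)) hz.2, comap_map_sup_span X hz.2⟩,
      sup_le (Submodule.map_le_iff_le_comap.2 hX) (by simpa using hz.1)⟩)
  have hcard (Y : Submodule F (Fin (n + 1) → F)) (hY : ¬ Y ≤ LinearMap.range (incl F n)) :
      Finset.card ({z | z ∈ Y ∧ z (Fin.last n) = 1} : Finset (Fin (n + 1) → F)) =
        Fintype.card F ^ Module.finrank F (Y.comap (incl F n)) := by
    rw [← card_last_eq_one hY, Nat.card_eq_fintype_card, Fintype.card_subtype]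
  rw [hcard Z hZ, Finset.sum_congr rfl (g := fun _ => Fintype.card F ^ Module.finrank F X),
    Finset.sum_const, smul_eq_mul] at key
  · have hle := Submodule.finrank_mono hX
    rw [← Nat.sub_add_cancel hle, pow_add] at key
    exact (Nat.eq_of_mul_eq_mul_right (pow_pos Fintype.card_pos _) key).symm
  · intro Y hY
    simp only [Finset.mem_filter, Finset.mem_univ, true_and] at hY
    obtain ⟨⟨h1, rfl⟩, h2⟩ := hY
    rw [← hcard Y h1]
    congr 1
    ext z
    simp only [Finset.mem_filter, Finset.mem_univ, true_and]
    constructor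
    · rintro ⟨⟨-, hz⟩, h⟩
      exact ⟨h ▸ Submodule.mem_sup_right (Submodule.mem_span_singleton_self z), hz⟩
    · rintro ⟨hz, h⟩
      exact ⟨⟨h2 hz, h⟩, (eq_map_comap_sup_span hz h).symm⟩


end Hyperplane

/-! ### Pivots as leading positions. -/

section Pivots

variable {F : Type*} [Field F] {n : ℕ}

/-- `i` is the position of the last nonzero entry of some vector of `X`. -/
def IsLeading (X : Submodule F (Fin n → F)) (i : Fin n) : Prop :=
  ∃ x ∈ X, x i = 1 ∧ ∀ j, i < j → x j = 0

lemma exists_isLeading {X : Submodule F (Fin n → F)} {x : Fin n → F} (hx : x ∈ X) (h0 : x ≠ 0) :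
    ∃ i, IsLeading X i ∧ x i ≠ 0 := by
  classical
  obtain ⟨i₀, hi₀⟩ := Function.ne_iff.1 h0
  have hne : ({i | x i ≠ 0} : Finset (Fin n)).Nonempty := ⟨i₀, by simpa using hi₀⟩
  obtain ⟨i, hi, hmax⟩ := Finset.exists_max_image _ id hne
  simp only [Finset.mem_filter, Finset.mem_univ, true_and, id] at hi hmax
  refine ⟨i, ⟨(x i)⁻¹ • x, X.smul_mem _ hx, by simp [hi], fun j hj => ?_⟩, hi⟩
  by_contra h
  exact hj.not_ge (hmax j fun h' => h (by simp [h']))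

/-- Every leading position of `X` is the leading position of a reduced vector of `X`. -/
lemma exists_reduced {X : Submodule F (Fin n → F)} {i : Fin n} (hi : IsLeading X i) :
    ∃ x ∈ X, x i = 1 ∧ (∀ j, i < j → x j = 0) ∧ ∀ j, IsLeading X j → j ≠ i → x j = 0 := by
  -- Elimination runs from the last coordinate down, `t` being the number of coordinates treated.
  -- Subtracting a vector with leading position `l` leaves the coordinates beyond `l` unchanged.
  suffices H : ∀ t ≤ n, ∃ x ∈ X, x i = 1 ∧ (∀ j, i < j → x j = 0) ∧
      ∀ j, IsLeading X j → j ≠ i → n - t ≤ (j : ℕ) → x j = 0 by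
    obtain ⟨x, hx, h1, h2, h3⟩ := H n le_rfl
    exact ⟨x, hx, h1, h2, fun j hj hji => h3 j hj hji (by simp)⟩
  intro t
  induction t with
  | zero =>
    obtain ⟨x, hx, h1, h2⟩ := hi
    exact fun _ => ⟨x, hx, h1, h2, fun j _ _ h => absurd j.isLt (by omega)⟩
  | succ t ih =>
    intro ht
    obtain ⟨x, hx, h1, h2, h3⟩ := ih (by omega)
    let l : Fin n := ⟨n - (t + 1), by omega⟩
    have hl : (l : ℕ) = n - (t + 1) := rfl
    by_cases hc : IsLeading X l ∧ l < i
    · obtain ⟨⟨y, hy, hy1, hy2⟩, hli⟩ := hc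
      refine ⟨x - x l • y, X.sub_mem hx (X.smul_mem _ hy), ?_, fun j hj => ?_,
        fun j hj hji hle => ?_⟩
      · simp [h1, hy2 i hli]
      · simp [h2 j hj, hy2 j (hli.trans hj)]
      · rcases eq_or_ne j l with rfl | hjl
        · simp [hy1]
        · have hlj : (l : ℕ) < j := lt_of_le_of_ne hle fun h => hjl (Fin.ext h.symm)
          simp [hy2 j hlj, h3 j hj hji (by omega)]
    · refine ⟨x, hx, h1, h2, fun j hj hji hle => ?_⟩
      rcases eq_or_ne j l with rfl | hjl
      · exact h2 _ (lt_of_le_of_ne (not_lt.1 fun h => hc ⟨hj, h⟩) hji.symm)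
      · have hlj : (l : ℕ) ≠ j := fun h => hjl (Fin.ext h.symm)
        exact h3 j hj hji (by omega)

/-- Frees the pivots from any choice of matrix. Conversely, the reduced vectors at all leading
positions are the columns of a normal form. -/
lemma mem_pivots {X : Submodule F (Fin n → F)} {i : Fin n} : i ∈ pivots X ↔ IsLeading X i := by
  classical
  simp only [pivots, Finset.mem_filter, Finset.mem_univ, true_and]
  constructor
  · rintro ⟨k, M, r, hM, rfl, j, rfl⟩
    exact ⟨M.col j, Submodule.subset_span ⟨j, rfl⟩, hM.pivot_eq_one j,
      fun l hl => hM.zero_below j l hl⟩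
  · intro hi
    let L : Finset (Fin n) := {l | IsLeading X l}
    have hL {l} : l ∈ L ↔ IsLeading X l := by simp [L]
    let r := L.orderEmbOfFin rfl
    have hr (j) : IsLeading X (r j) := hL.1 (L.orderEmbOfFin_mem rfl j)
    have hrange {l} (hl : IsLeading X l) : l ∈ Set.range r := by
      rw [Finset.range_orderEmbOfFin]
      exact hL.2 hl
    choose y hyX hy1 hy2 hy3 using fun j => exists_reduced (hr j)
    refine ⟨L.card, Matrix.of fun i j => y j i, r, ⟨hy1, fun j i => hy2 j i, r.strictMono, ?_⟩,
      le_antisymm (Submodule.span_le.2 ?_) fun x hx => ?_, hrange hi⟩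
    · ext a b
      rcases eq_or_ne a b with rfl | hab
      · simpa using hy1 a
      · simpa [hab] using hy3 b (r a) (hr a) (r.injective.ne hab)
    · rintro _ ⟨j, rfl⟩
      exact hyX j
    · have hz : x - ∑ j, x (r j) • y j = 0 := by
        by_contra h0
        obtain ⟨l, hl, hne⟩ := exists_isLeading
          (X.sub_mem hx (X.sum_mem fun j _ => X.smul_mem (x (r j)) (hyX j))) h0
        obtain ⟨b, rfl⟩ := hrange hl
        refine hne ?_
        rw [Pi.sub_apply, Finset.sum_apply, Finset.sum_eq_single b]
        · simp [hy1]
        · intro j _ hj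
          simp [hy3 j (r b) (hr b) (r.injective.ne hj.symm)]
        · simp
      rw [sub_eq_zero.1 hz]
      exact Submodule.sum_mem _ fun j _ =>
        Submodule.smul_mem _ _ (Submodule.subset_span ⟨j, rfl⟩)

/-- A vector whose leading position precedes the last one lies in the hyperplane, hence in the
trace. -/
lemma castSucc_mem_pivots {Z : Submodule F (Fin (n + 1) → F)} {i : Fin n} :
    i.castSucc ∈ pivots Z ↔ i ∈ pivots (Z.comap (incl F n)) := by
  rw [mem_pivots, mem_pivots]
  constructor
  · rintro ⟨z, hz, h1, h2⟩
    obtain ⟨x, rfl⟩ := mem_range_incl.2 (h2 _ (Fin.castSucc_lt_last i))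
    exact ⟨x, hz, by simpa using h1, fun j hj => by
      simpa using h2 j.castSucc (Fin.castSucc_lt_castSucc_iff.2 hj)⟩
  · rintro ⟨x, hx, h1, h2⟩
    refine ⟨incl F n x, hx, by simpa using h1, fun j => ?_⟩
    refine Fin.lastCases (by simp) (fun l hl => ?_) j
    simpa using h2 l (Fin.castSucc_lt_castSucc_iff.1 hl)

lemma last_mem_pivots {Z : Submodule F (Fin (n + 1) → F)} :
    Fin.last n ∈ pivots Z ↔ ¬ Z ≤ LinearMap.range (incl F n) := by
  rw [mem_pivots]
  constructor
  · rintro ⟨z, hz, h1, -⟩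
    exact not_le_range_of_mem hz h1
  · intro h
    obtain ⟨z, hz, h1⟩ := exists_mem_last_eq_one h
    exact ⟨z, hz, h1, fun j hj => absurd (Fin.le_last j) hj.not_ge⟩

end Pivots

/-! ### Statistics of 0/1 sequences and the classical cube. -/

section Sequences

variable {n : ℕ}

lemma weight_le (α : Fin n → Bool) : weight α ≤ n := by
  simpa [weight] using Finset.card_le_univ (ones α)

lemma weight_eq_sum (α : Fin n → Bool) : weight α = ∑ i, if α i = true then 1 else 0 := by
  rw [weight, ones, Finset.card_filter]

lemma weight_succ (α : Fin (n + 1) → Bool) :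
    weight α = weight (fun i => α i.castSucc) + if α (Fin.last n) = true then 1 else 0 := by
  simp only [weight_eq_sum, Fin.sum_univ_castSucc]

lemma dist_eq_sum (α : Fin n → Bool) (i : Fin n) :
    dist α i = ∑ j, if j < i ∧ α j ≠ α i then 1 else 0 := by
  rw [dist, Finset.card_filter]

lemma dist_castSucc (α : Fin (n + 1) → Bool) (i : Fin n) :
    dist α i.castSucc = dist (fun i => α i.castSucc) i := by
  simp only [dist_eq_sum, Fin.sum_univ_castSucc, Fin.castSucc_lt_castSucc_iff]
  simp [(Fin.castSucc_lt_last i).not_gt]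

lemma dist_last_of_false (α : Fin (n + 1) → Bool) (h : α (Fin.last n) = false) :
    dist α (Fin.last n) = weight (fun i => α i.castSucc) := by
  rw [dist_eq_sum, Fin.sum_univ_castSucc]
  simp [-Finset.sum_boole, weight_eq_sum, h, Fin.castSucc_lt_last]

lemma dist_last_of_true (α : Fin (n + 1) → Bool) (h : α (Fin.last n) = true) :
    dist α (Fin.last n) = n - weight (fun i => α i.castSucc) := by
  have hc : (∑ i : Fin n, if α i.castSucc = false then 1 else 0) +
      weight (fun i => α i.castSucc) = n := by
    rw [weight_eq_sum, ← Finset.sum_add_distrib]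
    refine (Finset.sum_congr rfl (g := fun _ => 1) fun i _ => ?_).trans (by simp)
    cases α i.castSucc <;> simp
  rw [← Nat.eq_sub_of_add_eq hc]
  rw [dist_eq_sum, Fin.sum_univ_castSucc]
  simp [-Finset.sum_boole, h, Fin.castSucc_lt_last]

/-- With one factor per coordinate, induction can split off the last one, and toggling an element of
`T` alters one factor only. -/
lemma coeff_eq_prod (q : ℂ) (α : Fin n → Bool) (T : Finset (Fin n)) :
    coeff q α T = ∏ i, if i ∈ T then (if α i = true then -1 else 1) else q ^ dist α i := by
  rw [Finset.prod_ite, coeff, Finset.prod_ite, Finset.prod_const, Finset.prod_const_one, mul_one,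
    Finset.prod_pow_eq_pow_sum]
  congr 3
  · ext i
    simp [ones, and_comm]
  · ext i
    simp

lemma coeff_one (α : Fin n → Bool) (T : Finset (Fin n)) :
    coeff 1 α T = (-1) ^ (ones α ∩ T).card := by
  simp [coeff]

lemma qNum_succ (q : ℂ) (m : ℕ) : qNum q (m + 1) = qNum q m + q ^ m := by
  simp [qNum, Finset.sum_range_succ]

lemma qNum_succ' (q : ℂ) (m : ℕ) : qNum q (m + 1) = q * qNum q m + 1 := by
  simp [qNum, Finset.sum_range_succ', Finset.mul_sum, pow_succ']

/-- Moving along direction `i` multiplies the coefficient by `-1` or `1` according to `α i`; these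
signs add up to `n - 2k`. -/
lemma cubeMatrix_mulVec_coeff_one (α : Fin n → Bool) :
    (cubeMatrix n).mulVec (coeff 1 α) = ((n : ℂ) - 2 * (weight α : ℂ)) • coeff 1 α := by
  funext S
  have hnb : ({T | ((S \ T) ∪ (T \ S)).card = 1} : Finset (Finset (Fin n))) =
      Finset.univ.image fun i => symmDiff S {i} := by
    ext T
    simp only [Finset.mem_filter, Finset.mem_univ, true_and, Finset.mem_image,
      Finset.card_eq_one]
    refine exists_congr fun i => ?_
    change symmDiff S T = {i} ↔ _
    rw [eq_comm, ← symmDiff_right_inj (a := S), symmDiff_symmDiff_cancel_left]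
  have hflip (i : Fin n) :
      coeff 1 α (symmDiff S {i}) = (if α i = true then -1 else 1) * coeff 1 α S := by
    simp only [coeff_eq_prod, one_pow]
    rw [← Finset.prod_erase_mul _ _ (Finset.mem_univ i),
      ← Finset.prod_erase_mul (s := Finset.univ) (a := i)
        (f := fun j => if j ∈ S then (if α j = true then (-1 : ℂ) else 1) else 1)
        (Finset.mem_univ i)]
    rw [Finset.prod_congr rfl
      (g := fun j => if j ∈ S then (if α j = true then (-1 : ℂ) else 1) else 1)]
    · by_cases h : i ∈ S <;> cases α i <;> simp [Finset.mem_symmDiff, h]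
    · intro j hj
      have hji := Finset.ne_of_mem_erase hj
      simp [Finset.mem_symmDiff, hji]
  have hsum : (∑ i, if α i = true then (-1 : ℂ) else 1) = (n : ℂ) - 2 * weight α := by
    have hw : (weight α : ℂ) = ∑ i, if α i = true then 1 else 0 := by
      rw [weight_eq_sum]
      push_cast
      rfl
    rw [hw, Finset.mul_sum, eq_sub_iff_add_eq, ← Finset.sum_add_distrib]
    refine (Finset.sum_congr rfl (g := fun _ => 1) fun i _ => ?_).trans (by simp)
    cases α i <;> norm_num
  calc (cubeMatrix n).mulVec (coeff 1 α) S
      = ∑ T, if ((S \ T) ∪ (T \ S)).card = 1 then coeff 1 α T else 0 := by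
        simp [Matrix.mulVec, dotProduct, cubeMatrix]
    _ = ∑ i, coeff 1 α (symmDiff S {i}) := by
        rw [← Finset.sum_filter, hnb, Finset.sum_image]
        exact fun i _ j _ h => Finset.singleton_injective (symmDiff_right_injective S h)
    _ = _ := by
        simp only [hflip, ← Finset.sum_mul, hsum, Pi.smul_apply, smul_eq_mul]

end Sequences

/-! ### Coefficients of the vectors `v_α`. -/

section Vectors

variable {F : Type*} [Field F] [Fintype F] {n : ℕ}

-- `extend` is supported on the hyperplane and `theta` off it, so just one term of the recursion
-- survives at each `Z`.
open Classical in
lemma vec_succ_apply (α : Fin (n + 1) → Bool) (Z : Submodule F (Fin (n + 1) → F)) :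
    vec F (n + 1) α Z =
      (if Z ≤ LinearMap.range (incl F n) then (Fintype.card F : ℂ) ^ dist α (Fin.last n)
        else if α (Fin.last n) = true then -1 else 1) *
      vec F n (fun i => α i.castSucc) (Z.comap (incl F n)) := by
  cases h : α (Fin.last n) <;> by_cases hZ : Z ≤ LinearMap.range (incl F n)
  · simp [vec, h, hZ, theta_apply, extend_apply_of_le, dist_last_of_false]
  · simp [vec, h, hZ, theta_apply, extend_apply_of_not_le]
  · simp [vec, h, hZ, theta_apply, extend_apply_of_le, dist_last_of_true]
  · simp [vec, h, hZ, theta_apply, extend_apply_of_not_le]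

lemma vec_apply (α : Fin n → Bool) (X : Submodule F (Fin n → F)) :
    vec F n α X = coeff (Fintype.card F) α (pivots X) := by
  classical
  induction n with
  | zero =>
    rw [Subsingleton.elim X ⊥, coeff_eq_prod]
    simp [vec]
  | succ n ih =>
    rw [vec_succ_apply, ih, coeff_eq_prod, coeff_eq_prod, Fin.prod_univ_castSucc, mul_comm]
    simp only [castSucc_mem_pivots, last_mem_pivots, dist_castSucc, ite_not]

lemma vec_eq_sum (α : Fin n → Bool) :
    vec F n α = ∑ X : Submodule F (Fin n → F),
      coeff (Fintype.card F) α (pivots X) • Finsupp.single X (1 : ℂ) := by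
  classical
  ext Y
  simp [vec_apply, Finsupp.single_apply]

/-- The exponent grows by `k` or by `n - k`: `k(n-k) + k = k(n+1-k)` and `k(n-k) + (n-k) =
(k+1)(n-k)`. -/
lemma vec_bot (α : Fin n → Bool) :
    vec F n α ⊥ = (Fintype.card F : ℂ) ^ (weight α * (n - weight α)) := by
  induction n with
  | zero => simp [vec]
  | succ n ih =>
    have hle := weight_le fun i => α i.castSucc
    rw [vec_succ_apply, if_pos bot_le, Submodule.comap_bot,
      LinearMap.ker_eq_bot.2 incl_injective, ih, ← pow_add, weight_succ α]
    obtain ⟨m, hm⟩ := Nat.exists_eq_add_of_le hle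
    cases h : α (Fin.last n)
    · rw [dist_last_of_false α h]
      simp only [Bool.false_eq_true, if_false, add_zero]
      congr 1
      rw [show n + 1 - weight (fun i => α i.castSucc) =
        n - weight (fun i => α i.castSucc) + 1 by omega]
      ring
    · rw [dist_last_of_true α h]
      simp only [if_true, Nat.add_sub_add_right]
      congr 1
      ring

lemma vec_top (α : Fin n → Bool) : vec F n α ⊤ = (-1) ^ weight α := by
  induction n with
  | zero =>
    rw [Subsingleton.elim (⊤ : Submodule F (Fin 0 → F)) ⊥]
    simp [vec, weight_eq_sum]
  | succ n ih =>
    have h1 : ¬ (⊤ : Submodule F (Fin (n + 1) → F)) ≤ LinearMap.range (incl F n) :=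
      not_le_range_of_mem (z := fun _ => 1) trivial rfl
    rw [vec_succ_apply, if_neg h1, Submodule.comap_top, ih, weight_succ α]
    cases h : α (Fin.last n) <;> simp [pow_succ]

end Vectors

/-! ### The block structure of `M_q(n + 1)` and the eigenvalues. -/

section Eigenvectors

variable {F : Type*} [Field F] [Fintype F] {n : ℕ}

open Classical in
lemma sum_subspaces_succ (g : Submodule F (Fin (n + 1) → F) → ℂ) :
    ∑ Z, g Z = ∑ X : Submodule F (Fin n → F), (g (X.map (incl F n)) +
      ∑ Y with ¬ Y ≤ LinearMap.range (incl F n) ∧ Y.comap (incl F n) = X, g Y) := by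
  rw [← Finset.sum_filter_add_sum_filter_not Finset.univ
    (fun Z => Z ≤ LinearMap.range (incl F n)), Finset.sum_add_distrib]
  congr 1
  · refine Finset.sum_bij' (fun Z _ => Z.comap (incl F n)) (fun X _ => X.map (incl F n))
      (by simp) (by simp [map_incl_le_range]) ?_ ?_ ?_
    · exact fun Z hZ => map_comap_incl (Finset.mem_filter.1 hZ).2
    · exact fun X _ => comap_map_incl X
    · exact fun Z hZ => by rw [map_comap_incl (Finset.mem_filter.1 hZ).2]
  · rw [← Finset.sum_fiberwise _ (fun Z => Z.comap (incl F n))]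
    simp only [Finset.filter_filter]

lemma qCubeMatrix_map_map (X X' : Submodule F (Fin n → F)) :
    qCubeMatrix F (n + 1) (X.map (incl F n)) (X'.map (incl F n)) = qCubeMatrix F n X X' := by
  classical
  have h (X X' : Submodule F (Fin n → F)) :
      (X'.map (incl F n) ≤ X.map (incl F n) ∧ Module.finrank F (X.map (incl F n)) =
        Module.finrank F (X'.map (incl F n)) + 1) ↔
      (X' ≤ X ∧ Module.finrank F X = Module.finrank F X' + 1) := by
    rw [map_incl_le_iff, comap_map_incl, finrank_map_incl, finrank_map_incl]
  exact if_congr (h X X') rfl (if_congr (h X' X) (by rw [finrank_map_incl]) rfl)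

open Classical in
lemma qCubeMatrix_map_of_not_le {Z : Submodule F (Fin (n + 1) → F)}
    (hZ : ¬ Z ≤ LinearMap.range (incl F n)) (X : Submodule F (Fin n → F)) :
    qCubeMatrix F (n + 1) Z (X.map (incl F n)) = if X = Z.comap (incl F n) then 1 else 0 := by
  have h1 : ¬ Z ≤ X.map (incl F n) := fun h => hZ (h.trans (map_incl_le_range X))
  have h2 : (X ≤ Z.comap (incl F n) ∧
      Module.finrank F (Z.comap (incl F n)) + 1 = Module.finrank F X + 1) ↔
      X = Z.comap (incl F n) :=
    ⟨fun h => Submodule.eq_of_le_of_finrank_eq h.1 (by omega), fun h => by rw [← h]; simp⟩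
  simp only [qCubeMatrix, Matrix.of_apply, finrank_of_not_le hZ, finrank_map_incl, map_incl_le_iff,
    h1, h2, false_and, if_false]

-- There are `q ^ (n - dim X)` subspaces off the hyperplane with trace `X`, each with entry `q ^ dim
-- X`; the weights in `M_q` make the total independent of `X`.
open Classical in
lemma sum_qCubeMatrix_of_le (X X' : Submodule F (Fin n → F)) :
    (∑ Y with ¬ Y ≤ LinearMap.range (incl F n) ∧ Y.comap (incl F n) = X',
      qCubeMatrix F (n + 1) (X.map (incl F n)) Y) =
      if X' = X then (Fintype.card F : ℂ) ^ n else 0 := by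
  have hentry : ∀ Y ∈ ({Y | ¬ Y ≤ LinearMap.range (incl F n) ∧ Y.comap (incl F n) = X'} :
      Finset (Submodule F (Fin (n + 1) → F))),
      qCubeMatrix F (n + 1) (X.map (incl F n)) Y =
        if X' = X then (Fintype.card F : ℂ) ^ Module.finrank F X else 0 := by
    intro Y hY
    obtain ⟨hYn, rfl⟩ := (Finset.mem_filter.1 hY).2
    have h1 : ¬ Y ≤ X.map (incl F n) := fun h => hYn (h.trans (map_incl_le_range X))
    have h2 : (X ≤ Y.comap (incl F n) ∧
        Module.finrank F (Y.comap (incl F n)) + 1 = Module.finrank F X + 1) ↔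
        Y.comap (incl F n) = X :=
      ⟨fun h => (Submodule.eq_of_le_of_finrank_eq h.1 (by omega)).symm,
        fun h => by rw [h]; simp⟩
    simp only [qCubeMatrix, Matrix.of_apply, finrank_of_not_le hYn, finrank_map_incl,
      map_incl_le_iff, h1, h2, false_and, if_false]
  rw [Finset.sum_congr rfl hentry, Finset.sum_const]
  split_ifs with h
  · subst h
    have h1 : ¬ (⊤ : Submodule F (Fin (n + 1) → F)) ≤ LinearMap.range (incl F n) :=
      not_le_range_of_mem (z := fun _ => 1) trivial rfl
    have htop : Module.finrank F
        ((⊤ : Submodule F (Fin (n + 1) → F)).comap (incl F n)) = n := by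
      rw [Submodule.comap_top, finrank_top, Module.finrank_fin_fun]
    have hc := card_le_comap_eq h1 (X := X') (by simp)
    simp only [le_top, and_true, htop] at hc
    rw [hc, nsmul_eq_mul]
    push_cast
    rw [← pow_add, Nat.sub_add_cancel]
    simpa using Submodule.finrank_le X'
  · simp

-- The factor `q` has two sources. Below the trace there are `q` subspaces `Y`, each with entry `1`;
-- above it there is a single `Y`, and its weight `q ^ dim Z` has exponent one more than the
-- dimension of the trace.
open Classical in
lemma sum_qCubeMatrix_of_not_le {Z : Submodule F (Fin (n + 1) → F)}
    (hZ : ¬ Z ≤ LinearMap.range (incl F n)) (X : Submodule F (Fin n → F)) :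
    (∑ Y with ¬ Y ≤ LinearMap.range (incl F n) ∧ Y.comap (incl F n) = X,
      qCubeMatrix F (n + 1) Z Y) =
      Fintype.card F * qCubeMatrix F n (Z.comap (incl F n)) X := by
  by_cases hdown : X ≤ Z.comap (incl F n) ∧
      Module.finrank F (Z.comap (incl F n)) = Module.finrank F X + 1
  · have hentry : ∀ Y ∈ ({Y | ¬ Y ≤ LinearMap.range (incl F n) ∧ Y.comap (incl F n) = X} :
        Finset (Submodule F (Fin (n + 1) → F))),
        qCubeMatrix F (n + 1) Z Y = if Y ≤ Z then 1 else 0 := by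
      intro Y hY
      obtain ⟨hYn, rfl⟩ := (Finset.mem_filter.1 hY).2
      simp [qCubeMatrix, finrank_of_not_le hYn, finrank_of_not_le hZ, hdown.2, add_assoc]
    rw [Finset.sum_congr rfl hentry, ← Finset.sum_filter, Finset.filter_filter, Finset.sum_const,
      card_le_comap_eq hZ hdown.1, hdown.2]
    simp [qCubeMatrix, hdown]
  by_cases hup : Z.comap (incl F n) ≤ X ∧
      Module.finrank F X = Module.finrank F (Z.comap (incl F n)) + 1
  · obtain ⟨z, hz, h⟩ := exists_mem_last_eq_one hZ
    have hz' : z ∈ X.map (incl F n) ⊔ Submodule.span F {z} :=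
      Submodule.mem_sup_right (Submodule.mem_span_singleton_self z)
    have hd : Module.finrank F ↥(X.map (incl F n) ⊔ Submodule.span F {z}) =
        Module.finrank F X + 1 := by
      rw [finrank_of_not_le (not_le_range_of_mem hz' h), comap_map_sup_span X h]
    -- A `Y` with trace `X` that contains `Z` contains `z`, which determines it.
    rw [Finset.sum_eq_single (X.map (incl F n) ⊔ Submodule.span F {z})]
    · have hle : Z ≤ X.map (incl F n) ⊔ Submodule.span F {z} := by
        conv_lhs => rw [eq_map_comap_sup_span hz h]
        exact sup_le_sup_right (Submodule.map_mono hup.1) _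
      simp [qCubeMatrix, finrank_of_not_le hZ, hd, hup, hle, pow_succ', add_assoc]
    · intro Y hY hne
      obtain ⟨hYn, rfl⟩ := (Finset.mem_filter.1 hY).2
      have hle : ¬ Z ≤ Y := fun hle => hne (eq_map_comap_sup_span (hle hz) h)
      simp [qCubeMatrix, finrank_of_not_le hZ, finrank_of_not_le hYn, hup.2, hle, add_assoc]
    · intro hmem
      exact absurd (Finset.mem_filter.2 ⟨Finset.mem_univ _, not_le_range_of_mem hz' h,
        comap_map_sup_span X h⟩) hmem
  · have h0 : qCubeMatrix F n (Z.comap (incl F n)) X = 0 := by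
      simp [qCubeMatrix, hdown, hup]
    rw [h0, mul_zero]
    refine Finset.sum_eq_zero fun Y hY => ?_
    obtain ⟨hYn, rfl⟩ := (Finset.mem_filter.1 hY).2
    have h1 : ¬ (Y ≤ Z ∧ Module.finrank F Z = Module.finrank F Y + 1) := fun h => hdown
      ⟨Submodule.comap_mono h.1, by
        have := h.2
        rw [finrank_of_not_le hZ, finrank_of_not_le hYn] at this
        omega⟩
    have h2 : ¬ (Z ≤ Y ∧ Module.finrank F Y = Module.finrank F Z + 1) := fun h => hup
      ⟨Submodule.comap_mono h.1, by
        have := h.2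
        rw [finrank_of_not_le hZ, finrank_of_not_le hYn] at this
        omega⟩
    simp [qCubeMatrix, h1, h2]

open Classical in
/-- The action of `M_q(n+1)` on a vector that is built from a vector of length `n`. -/
lemma qCubeMatrix_mulVec_succ (a s : ℂ) (v : Submodule F (Fin n → F) → ℂ)
    (Z : Submodule F (Fin (n + 1) → F)) :
    (qCubeMatrix F (n + 1)).mulVec (fun Z => (if Z ≤ LinearMap.range (incl F n) then a else s) *
      v (Z.comap (incl F n))) Z =
    if Z ≤ LinearMap.range (incl F n) then
      a * (qCubeMatrix F n).mulVec v (Z.comap (incl F n)) +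
        s * Fintype.card F ^ n * v (Z.comap (incl F n))
    else a * v (Z.comap (incl F n)) +
      s * Fintype.card F * (qCubeMatrix F n).mulVec v (Z.comap (incl F n)) := by
  have key : (qCubeMatrix F (n + 1)).mulVec
      (fun Z => (if Z ≤ LinearMap.range (incl F n) then a else s) * v (Z.comap (incl F n))) Z =
      ∑ X, (a * v X * qCubeMatrix F (n + 1) Z (X.map (incl F n)) + s * v X *
        ∑ Y with ¬ Y ≤ LinearMap.range (incl F n) ∧ Y.comap (incl F n) = X,
          qCubeMatrix F (n + 1) Z Y) := by
    rw [Matrix.mulVec, dotProduct, sum_subspaces_succ]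
    refine Finset.sum_congr rfl fun X _ => ?_
    rw [if_pos (map_incl_le_range X), comap_map_incl, Finset.mul_sum]
    congr 1
    · ring
    · refine Finset.sum_congr rfl fun Y hY => ?_
      obtain ⟨hYn, rfl⟩ := (Finset.mem_filter.1 hY).2
      rw [if_neg hYn]
      ring
  rw [key]
  split_ifs with hZ
  · obtain ⟨X, rfl⟩ : ∃ X, Submodule.map (incl F n) X = Z := ⟨_, map_comap_incl hZ⟩
    simp only [qCubeMatrix_map_map, sum_qCubeMatrix_of_le, comap_map_incl, mul_ite, mul_zero,
      Finset.sum_add_distrib, Finset.sum_ite_eq', Finset.mem_univ, if_true, Matrix.mulVec,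
      dotProduct, Finset.mul_sum]
    congr 1
    · exact Finset.sum_congr rfl fun _ _ => by ring
    · ring
  · simp only [qCubeMatrix_map_of_not_le hZ, sum_qCubeMatrix_of_not_le hZ, mul_ite, mul_zero,
      mul_one, Finset.sum_add_distrib, Finset.sum_ite_eq', Finset.mem_univ, if_true,
      Matrix.mulVec, dotProduct, Finset.mul_sum]
    congr 1
    exact Finset.sum_congr rfl fun _ _ => by ring

lemma qCubeMatrix_mulVec_vec (α : Fin n → Bool) :
    (qCubeMatrix F n).mulVec (vec F n α) =
      (qNum (Fintype.card F) (n - weight α) - qNum (Fintype.card F) (weight α)) •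
        ⇑(vec F n α) := by
  classical
  induction n with
  | zero =>
    funext X
    have hw : weight α = 0 := Nat.le_zero.1 (weight_le α)
    rw [Subsingleton.elim X default]
    simp [hw, Matrix.mulVec, dotProduct, qCubeMatrix]
  | succ n ih =>
    funext Z
    have hle := weight_le fun i => α i.castSucc
    have hs := qCubeMatrix_mulVec_succ ((Fintype.card F : ℂ) ^ dist α (Fin.last n))
      (if α (Fin.last n) = true then -1 else 1) (vec F n fun i => α i.castSucc) Z
    simp only [← vec_succ_apply, ih] at hs
    simp only [hs, Pi.smul_apply, vec_succ_apply, smul_eq_mul, weight_succ α]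
    obtain ⟨m, hm⟩ := Nat.exists_eq_add_of_le hle
    have hm' : n - weight (fun i => α i.castSucc) = m := by omega
    have hm'' : n + 1 - weight (fun i => α i.castSucc) = m + 1 := by omega
    -- Needed off the hyperplane: it gives `q λ - λ = q^m - q^k`, so `q^k + q λ = λ + q^m`. On the
    -- hyperplane, factoring `q ^ n` as `q^k q^m` suffices.
    have h1 (j : ℕ) : (Fintype.card F : ℂ) * qNum (Fintype.card F) j =
        qNum (Fintype.card F) j + Fintype.card F ^ j - 1 := by
      rw [← qNum_succ, qNum_succ', add_sub_cancel_right]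
    have hn : (Fintype.card F : ℂ) ^ n = Fintype.card F ^ weight (fun i => α i.castSucc) *
        Fintype.card F ^ m := by rw [← pow_add, ← hm]
    cases h : α (Fin.last n)
    · simp only [dist_last_of_false α h, Bool.false_eq_true, if_false, add_zero, hm', hm'',
        qNum_succ, hn]
      split_ifs
      · ring
      · linear_combination (h1 m - h1 (weight fun i => α i.castSucc)) *
          vec F n (fun i => α i.castSucc) (Z.comap (incl F n))
    · simp only [dist_last_of_true α h, if_true, Nat.add_sub_add_right, hm', qNum_succ, hn]
      split_ifs
      · ring
      · linear_combination -(h1 m - h1 (weight fun i => α i.castSucc)) *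
          vec F n (fun i => α i.castSucc) (Z.comap (incl F n))

end Eigenvectors

end QCube

theorem mainTheorem5 {F : Type*} [Field F] [Fintype F] (n : ℕ) (α : Fin n → Bool) :
    -- the vectors are nonzero and are eigenvectors of the `q`-analog of the `n`-cube matrix
    (QCube.vec F n α ≠ 0 ∧
      (QCube.qCubeMatrix F n).mulVec (QCube.vec F n α) =
        (QCube.qNum (Fintype.card F) (n - QCube.weight α) -
          QCube.qNum (Fintype.card F) (QCube.weight α)) • ⇑(QCube.vec F n α)) ∧
    -- the explicit formula
    QCube.vec F n α =
      ∑ X : Submodule F (Fin n → F),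
        QCube.coeff (Fintype.card F) α (QCube.pivots X) • Finsupp.single X (1 : ℂ) ∧
    -- the two extreme coefficients
    QCube.vec F n α ⊥ = (Fintype.card F : ℂ) ^ (QCube.weight α * (n - QCube.weight α)) ∧
    QCube.vec F n α ⊤ = (-1) ^ QCube.weight α ∧
    -- at `q = 1` the formula gives the classical eigenvectors of the `n`-cube
    (∀ T : Finset (Fin n), QCube.coeff 1 α T = (-1) ^ (QCube.ones α ∩ T).card) ∧
    (QCube.cubeMatrix n).mulVec (QCube.coeff 1 α) =
      ((n : ℂ) - 2 * (QCube.weight α : ℂ)) • QCube.coeff 1 α := by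
  refine ⟨⟨fun h => ?_, QCube.qCubeMatrix_mulVec_vec α⟩, QCube.vec_eq_sum α, QCube.vec_bot α,
    QCube.vec_top α, QCube.coeff_one α, QCube.cubeMatrix_mulVec_coeff_one α⟩
  -- The coefficient of the whole space is a sign, hence not zero.
  have htop := QCube.vec_top (F := F) α
  rw [h, Finsupp.coe_zero, Pi.zero_apply] at htop
  exact pow_ne_zero _ (neg_ne_zero.2 one_ne_zero) htop.symm
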